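/- Let $(\mathcal K,\Sigma,\otimes,\mathbb 1)$ be a tensor triangulated category: a triangulated category with a symmetric monoidal structure that is exact in each variable, whose suspension isomorphisms $\Sigma a\otimes b\simeq\Sigma(a\otimes b)\simeq a\otimes\Sigma b$ are compatible with the symmetry, unitors and associator, and such that the two resulting identifications of $\Sigma a\otimes\Sigma b$ with $\Sigma^2(a\otimes b)$ differ by the sign $-1$. Let $\operatorname{Spc}(\mathcal K)$ be the set of primes of $\mathcal K$ (proper thick triangulated $\otimes$-ideals $\mathcal P$ such that $a\otimes b\in\mathcal P$ implies $a\in\mathcal P$ or $b\in\mathcal P$), with the topology for which the sets $\operatorname{supp}(a)=\{\mathcal P\mid a\notin\mathcal P\}$, $a\in\mathcal K$, form a basis of closed sets. Let $X$ be an object of $\mathcal K$, and give $\operatorname{supp}(X)$ the subspace topology. A map is called spectral if it is continuous and preimages of quasi-compact open subsets are quasi-compact. (1) Let $E_X=\{f\in\operatorname{End}_{\mathcal K}(X)\mid f\otimes X=X\otimes f\}$ be the ring of $\otimes$-balanced endomorphisms of $X$. For every commutative ring $A$ and every ring homomorphism $\alpha:A\to E_X$, the rule $$\rho_{X,A}(\mathcal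 P)=\{a\in A\mid \operatorname{cone}(\alpha(a))\notin\mathcal P\}$$ defines an inclusion-reversing, spectral map $\rho_{X,A}:\operatorname{supp}(X)\to\operatorname{Spec}(A)$. (2) Let $E_X^\bullet$ be the $\mathbb Z$-graded ring whose degree-$i$ part consists of the morphisms $f:\Sigma^iX\to X$ that are $\otimes$-balanced, i.e. for which the composites $\Sigma^i(X\otimes X)\simeq\Sigma^iX\otimes X\xrightarrow{f\otimes X}X\otimes X$ and $\Sigma^i(X\otimes X)\simeq X\otimes\Sigma^iX\xrightarrow{X\otimes f}X\otimes X$ agree, with product $f\cdot g=f\circ\Sigma^i g$ for $f$ of degree $i$. For every $\mathbb Z$-graded ring $A^\bullet$ that is commutative or graded-commutative ($ab=(-1)^{ij}ba$ for $a\in A^i$, $b\in A^j$) and every graded ring homomorphism $\alpha:A^\bullet\to E_X^\bullet$, the rule $$\rho^\bullet_{X,A^\bullet}(\mathcal P)=\{a\in A^i\mid \operatorname{cone}(\alpha(a))\notin\mathcal P\}_{i\in\mathbb Z}$$ defines an inclusion-reversing, spectral map $\rho^\bullet_{X,A^\bullet}:\operatorname{supp}(X)\to\operatorname{Spec}^{h}(A^\bullet)$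 to the space of homogeneous prime ideals of $A^\bullet$ with the Zariski topology. -/

import Mathlib

open CategoryTheory CategoryTheory.Limits CategoryTheory.Pretriangulated
  CategoryTheory.MonoidalCategory

universe v u w

namespace TTGeometry

/-! ### Tensor triangulated categories -/

section TensorTriangulated

variable {K : Type u} [Category.{v} K] [Preadditive K] [HasShift K ℤ]
  [∀ n : ℤ, (shiftFunctor K n).Additive] [MonoidalCategory K]
  [(curriedTensor K).CommShift₂Int]

/-- The suspension isomorphism `Σⁿ a ⊗ b ≅ Σⁿ (a ⊗ b)`. -/
noncomputable def shiftTensorIso (n : ℤ) (a b : K) :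
    a⟦n⟧ ⊗ b ≅ (a ⊗ b)⟦n⟧ :=
  (((curriedTensor K).flip.obj b).commShiftIso n).app a

/-- The suspension isomorphism `a ⊗ Σⁿ b ≅ Σⁿ (a ⊗ b)`. -/
noncomputable def tensorShiftIso (n : ℤ) (a b : K) :
    a ⊗ b⟦n⟧ ≅ (a ⊗ b)⟦n⟧ :=
  (((curriedTensor K).obj a).commShiftIso n).app b

variable (K) in
/-- A tensor triangulated category: a triangulated category with a symmetric monoidal structure
which is exact in each variable.  The suspension isomorphisms in the two variables are the data
`(curriedTensor K).CommShift₂Int`; they are natural in both variables, and the two ways of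
identifying `Σ a ⊗ Σ b` with `Σ² (a ⊗ b)` anticommute (`Functor.CommShift₂.comm`, where the sign
for `Σᵐ a ⊗ Σⁿ b` is `(-1) ^ (m * n)`).  The fields say that the tensor product is exact in each
variable and that the suspension isomorphisms are compatible with the symmetry, the unitors and
the associator. -/
class TensorTriangulatedCategory [HasZeroObject K] [Pretriangulated K]
    [IsTriangulated K] [SymmetricCategory K] [MonoidalPreadditive K] : Prop where
  exact_left (a : K) : ((curriedTensor K).obj a).IsTriangulated
  exact_right (b : K) : ((curriedTensor K).flip.obj b).IsTriangulated
  braiding (n : ℤ) (a b : K) :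
    (shiftTensorIso n a b).hom ≫ ((β_ a b).hom)⟦n⟧' =
      (β_ (a⟦n⟧) b).hom ≫ (tensorShiftIso n b a).hom
  rightUnitor (n : ℤ) (a : K) :
    (shiftTensorIso n a (𝟙_ K)).hom ≫ ((ρ_ a).hom)⟦n⟧' = (ρ_ (a⟦n⟧)).hom
  leftUnitor (n : ℤ) (a : K) :
    (tensorShiftIso n (𝟙_ K) a).hom ≫ ((λ_ a).hom)⟦n⟧' = (λ_ (a⟦n⟧)).hom
  associator_left (n : ℤ) (a b c : K) :
    (shiftTensorIso n a b).hom ▷ c ≫ (shiftTensorIso n (a ⊗ b) c).hom ≫ ((α_ a b c).hom)⟦n⟧' =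
      (α_ (a⟦n⟧) b c).hom ≫ (shiftTensorIso n a (b ⊗ c)).hom
  associator_middle (n : ℤ) (a b c : K) :
    (tensorShiftIso n a b).hom ▷ c ≫ (shiftTensorIso n (a ⊗ b) c).hom ≫ ((α_ a b c).hom)⟦n⟧' =
      (α_ a (b⟦n⟧) c).hom ≫ a ◁ (shiftTensorIso n b c).hom ≫ (tensorShiftIso n a (b ⊗ c)).hom
  associator_right (n : ℤ) (a b c : K) :
    (tensorShiftIso n (a ⊗ b) c).hom ≫ ((α_ a b c).hom)⟦n⟧' =
      (α_ a b (c⟦n⟧)).hom ≫ a ◁ (tensorShiftIso n b c).hom ≫ (tensorShiftIso n a (b ⊗ c)).hom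

end TensorTriangulated

/-! ### The spectrum of a tensor triangulated category -/

section Spectrum

variable (K : Type u) [Category.{v} K] [Preadditive K] [HasZeroObject K] [HasShift K ℤ]
  [∀ n : ℤ, (shiftFunctor K n).Additive] [Pretriangulated K] [MonoidalCategory K]

/-- A point of the spectrum: a proper thick triangulated `⊗`-ideal `P` of `K` such that
`a ⊗ b ∈ P` implies `a ∈ P` or `b ∈ P`. -/
@[ext]
structure Spc where
  /-- The class of objects belonging to the prime. -/
  carrier : ObjectProperty K
  isTriangulated : carrier.IsTriangulated
  isStableUnderRetracts : carrier.IsStableUnderRetracts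
  tensor_left (a : K) {b : K} : carrier b → carrier (a ⊗ b)
  tensor_right {a : K} (b : K) : carrier a → carrier (a ⊗ b)
  exists_not_mem : ∃ a : K, ¬ carrier a
  mem_or_mem {a b : K} : carrier (a ⊗ b) → carrier a ∨ carrier b

variable {K}

/-- `supp a` is the set of primes not containing `a`. -/
def supp (a : K) : Set (Spc K) := {P | ¬ P.carrier a}

/-- The topology on the spectrum having the supports as a basis of closed sets. -/
instance : TopologicalSpace (Spc K) :=
  TopologicalSpace.generateFrom {U | ∃ a : K, U = (supp a)ᶜ}

end Spectrum

/-- The cone of `f`: the third object of a (chosen) distinguished triangle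
`a ⟶ b ⟶ cone f ⟶ Σ a`; it is well-defined up to isomorphism. -/
noncomputable def cone {K : Type u} [Category.{v} K] [Preadditive K] [HasZeroObject K]
    [HasShift K ℤ] [∀ n : ℤ, (shiftFunctor K n).Additive] [Pretriangulated K]
    {a b : K} (f : a ⟶ b) : K :=
  (distinguished_cocone_triangle f).choose

/-! ### Balanced endomorphisms -/

/-- The ring `E_X` of `⊗`-balanced endomorphisms of `X`, i.e. of those `f : X ⟶ X` such that
`f ⊗ X = X ⊗ f`. The product of `End X` is composition `f * g = f ∘ g`. -/
def balancedEnd {K : Type u} [Category.{v} K] [Preadditive K] [MonoidalCategory K]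
    [MonoidalPreadditive K] (X : K) : Subring (End X) where
  carrier := {f | (f : X ⟶ X) ▷ X = X ◁ (f : X ⟶ X)}
  mul_mem' {f g} hf hg := by
    simp only [Set.mem_ofPred_eq, End.mul_def, comp_whiskerRight, whiskerLeft_comp] at *
    rw [hf, hg]
  one_mem' := by simp [End.one_def]
  add_mem' {f g} hf hg := by
    have h1 : (f + g : X ⟶ X) ▷ X = (f : X ⟶ X) ▷ X + (g : X ⟶ X) ▷ X :=
      MonoidalPreadditive.add_whiskerRight f g
    have h2 : X ◁ (f + g : X ⟶ X) = X ◁ (f : X ⟶ X) + X ◁ (g : X ⟶ X) :=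
      MonoidalPreadditive.whiskerLeft_add f g
    exact h1.trans ((congrArg₂ (· + ·) hf hg).trans h2.symm)
  zero_mem' := by
    have h1 : (0 : X ⟶ X) ▷ X = 0 := MonoidalPreadditive.zero_whiskerRight
    have h2 : X ◁ (0 : X ⟶ X) = 0 := MonoidalPreadditive.whiskerLeft_zero
    exact h1.trans h2.symm
  neg_mem' {f} hf := by
    have h1 : (-f : X ⟶ X) ▷ X = -((f : X ⟶ X) ▷ X) := (tensorRight X).map_neg (f := f)
    have h2 : X ◁ (-f : X ⟶ X) = -(X ◁ (f : X ⟶ X)) := (tensorLeft X).map_neg (f := f)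
    exact h1.trans ((congrArg Neg.neg hf).trans h2.symm)

/-! ### The graded version -/

section Graded

variable {K : Type u} [Category.{v} K] [Preadditive K] [HasShift K ℤ]

/-- The product `f ∘ Σⁱ g : Σⁱ⁺ʲ X ⟶ X` of graded endomorphisms `f : Σⁱ X ⟶ X` and
`g : Σʲ X ⟶ X`. -/
noncomputable def gradedMul {X : K} {i j : ℤ} (f : X⟦i⟧ ⟶ X) (g : X⟦j⟧ ⟶ X) :
    X⟦i + j⟧ ⟶ X :=
  (shiftFunctorAdd' K j i (i + j) (add_comm j i)).hom.app X ≫ g⟦i⟧' ≫ f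

/-- The unit `Σ⁰ X ≅ X` of the graded endomorphism ring of `X`. -/
noncomputable def gradedOne (X : K) : X⟦(0 : ℤ)⟧ ⟶ X :=
  (shiftFunctorZero K ℤ).hom.app X

/-- A graded endomorphism `f : Σᵏ X ⟶ X` is `⊗`-balanced (belongs to `E_X^k`) if the composites
`Σᵏ (X ⊗ X) ≅ Σᵏ X ⊗ X ⟶ X ⊗ X` (using `f ⊗ X`) and `Σᵏ (X ⊗ X) ≅ X ⊗ Σᵏ X ⟶ X ⊗ X`
(using `X ⊗ f`) agree. -/
def IsGradedBalanced [∀ n : ℤ, (shiftFunctor K n).Additive] [MonoidalCategory K]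
    [(curriedTensor K).CommShift₂Int] {X : K} {k : ℤ} (f : X⟦k⟧ ⟶ X) : Prop :=
  (shiftTensorIso k X X).inv ≫ f ▷ X = (tensorShiftIso k X X).inv ≫ X ◁ f

/-- Graded ring homomorphisms from a graded ring `A` to the graded ring `E_X^•` of `⊗`-balanced
graded endomorphisms of `X`. -/
structure GradedHomToBalanced [∀ n : ℤ, (shiftFunctor K n).Additive] [MonoidalCategory K]
    [(curriedTensor K).CommShift₂Int]
    {A : Type w} [Ring A] (𝒜 : ℤ → AddSubgroup A) [GradedRing 𝒜] (X : K) where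
  /-- The component in degree `i`. -/
  toFun (i : ℤ) : 𝒜 i →+ (X⟦i⟧ ⟶ X)
  balanced (i : ℤ) (a : 𝒜 i) : IsGradedBalanced (toFun i a)
  map_one : toFun 0 ⟨1, SetLike.GradedOne.one_mem⟩ = gradedOne X
  map_mul (i j : ℤ) (a : 𝒜 i) (b : 𝒜 j) :
    toFun (i + j) ⟨a * b, SetLike.GradedMul.mul_mem a.2 b.2⟩ =
      gradedMul (toFun i a) (toFun j b)

end Graded

section HomogeneousSpectrum

variable {A : Type w} [Ring A] (𝒜 : ℤ → AddSubgroup A) [GradedRing 𝒜]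

/-- `A` is commutative, or graded-commutative: `a b = (-1)^(i j) b a` for `a ∈ Aⁱ`, `b ∈ Aʲ`. -/
def IsCommOrGradedComm : Prop :=
  (∀ a b : A, a * b = b * a) ∨
    ∀ (i j : ℤ) (a b : A), a ∈ 𝒜 i → b ∈ 𝒜 j →
      a * b = (((-1 : ℤˣ) ^ (i * j) : ℤˣ) : ℤ) • (b * a)

/-- The homogeneous spectrum of a (graded-)commutative graded ring: proper homogeneous ideals
`p` such that for homogeneous `a`, `b`, `a b ∈ p` implies `a ∈ p` or `b ∈ p`.  (Homogeneous
elements commute up to sign, so that homogeneous left ideals are two-sided.) -/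
@[ext]
structure Spech where
  /-- The underlying homogeneous ideal. -/
  asIdeal : HomogeneousIdeal 𝒜
  ne_top : asIdeal.toIdeal ≠ ⊤
  mem_or_mem {a b : A} : SetLike.IsHomogeneousElem 𝒜 a → SetLike.IsHomogeneousElem 𝒜 b →
    a * b ∈ asIdeal.toIdeal → a ∈ asIdeal.toIdeal ∨ b ∈ asIdeal.toIdeal

/-- The Zariski topology on the homogeneous spectrum, with basic open sets
`D(a) = {p | a ∉ p}` for `a` homogeneous. -/
instance : TopologicalSpace (Spech 𝒜) :=
  TopologicalSpace.generateFrom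
    {U | ∃ a : A, SetLike.IsHomogeneousElem 𝒜 a ∧ U = {p | a ∉ p.asIdeal.toIdeal}}

end HomogeneousSpectrum

end TTGeometry

set_option linter.unusedSectionVars false

/-! For balanced `f`, both `X ◁ u` followed by `f ▷ cone f` and `f ▷ cone f` followed by `X ◁ v`
vanish, where `u`, `v` are the other maps of the triangle on `f`: balancedness moves `f` to the
second factor, where it meets `u` or `v`. Exactness then factors `f ▷ cone f` through `X ◁ v`, so
the square of `f` kills `cone f` (`comp_self_whiskerRight_cone`,
`IsGradedBalanced.gradedMul_self_whiskerRight_cone`).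

Conversely, if `f` is invertible modulo `P` and kills `d`, then `0` is invertible modulo `P` on `X ⊗
d`, so `X ⊗ d` lies in `P`, and hence so does `d` when `P` is in `supp X`
(`carrier_or_of_whiskerRight_eq_zero`). Therefore the ring elements not invertible modulo `P` form
an ideal: if a power of `a + b` lies in the ideal generated by `a²` and `b²`, it kills `cone a ⊗
cone b`, and `(ab)² = ±a²b²` kills `cone b`. Primality holds because isomorphisms modulo `P`
compose.

Spectrality: the preimage of `D(a)` is the complement of `supp (cone a)` in the closed set `supp X`,
and such complements are quasi-compact by an ultrafilter argument. -/

namespace TTGeometry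

/-! ### Ultrafilters of primes and a criterion for spectral maps. -/

section Spectrum

variable {K : Type u} [Category.{v} K] [Preadditive K] [HasZeroObject K] [HasShift K ℤ]
  [∀ n : ℤ, (shiftFunctor K n).Additive] [Pretriangulated K] [MonoidalCategory K]

instance (P : Spc K) : P.carrier.IsTriangulated := P.isTriangulated

instance (P : Spc K) : P.carrier.IsStableUnderRetracts := P.isStableUnderRetracts

instance (P : Spc K) : P.carrier.IsClosedUnderIsomorphisms where
  of_iso e h := P.carrier.prop_of_retract ⟨e.inv, e.hom, by simp⟩ h

lemma Spc.not_carrier_unit (P : Spc K) : ¬ P.carrier (𝟙_ K) := fun h => by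
  obtain ⟨a, ha⟩ := P.exists_not_mem
  exact ha (P.carrier.prop_of_iso (ρ_ a) (P.tensor_left a h))

/-- The objects which belong to the primes in a set of the filter `F`. -/
def eventuallyCarrier (F : Filter (Spc K)) : ObjectProperty K := fun a => ∀ᶠ P in F, P.carrier a

instance (F : Filter (Spc K)) : (eventuallyCarrier F).IsTriangulated where
  exists_zero := ⟨_, isZero_zero K, .of_forall fun P => P.carrier.prop_zero⟩
  isStableUnderShiftBy n := ⟨fun _ h => h.mono fun P hP => P.carrier.le_shift n _ hP⟩
  ext₂' T hT h₁ h₃ := by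
    refine ObjectProperty.le_isoClosure _ _ ?_
    filter_upwards [h₁, h₃] with P h₁ h₃
    exact P.carrier.ext_of_isTriangulatedClosed₂ T hT h₁ h₃

instance (F : Filter (Spc K)) : (eventuallyCarrier F).IsStableUnderRetracts where
  of_retract r h := h.mono fun P hP => P.carrier.prop_of_retract r hP

/-- The prime of objects which belong to almost all primes, with respect to an ultrafilter. -/
def ultrafilterPrime (F : Ultrafilter (Spc K)) : Spc K where
  carrier := eventuallyCarrier F
  isTriangulated := inferInstance
  isStableUnderRetracts := inferInstance
  tensor_left a _ h := h.mono fun P hP => P.tensor_left a hP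
  tensor_right b h := h.mono fun P hP => P.tensor_right b hP
  exists_not_mem := ⟨𝟙_ K, fun h => h.exists.elim fun P hP => P.not_carrier_unit hP⟩
  -- The only condition that needs an ultrafilter rather than a proper filter.
  mem_or_mem h := Ultrafilter.eventually_or.1 (h.mono fun P hP => P.mem_or_mem hP)

lemma le_nhds_ultrafilterPrime (F : Ultrafilter (Spc K)) :
    (F : Filter (Spc K)) ≤ nhds (ultrafilterPrime F) := by
  rw [TopologicalSpace.nhds_generateFrom]
  refine le_iInf₂ fun U hU => ?_
  obtain ⟨hmem, a, rfl⟩ := hU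
  have ha : (ultrafilterPrime F).carrier a := not_not.1 hmem
  exact Filter.le_principal_iff.2 (ha.mono fun P hP => not_not.2 hP)

lemma isCompact_compl_supp (c : K) : IsCompact (supp c)ᶜ := by
  rw [isCompact_iff_ultrafilter_le_nhds]
  intro F hF
  refine ⟨ultrafilterPrime F, ?_, le_nhds_ultrafilterPrime F⟩
  refine not_not.2 ?_
  have h : ∀ᶠ P in (F : Filter (Spc K)), P ∈ (supp c)ᶜ := Filter.le_principal_iff.1 hF
  exact h.mono fun P hP => not_not.1 hP

lemma isClosed_supp (c : K) : IsClosed (supp c) :=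
  ⟨TopologicalSpace.isOpen_generateFrom_of_mem ⟨c, rfl⟩⟩

/-- A quasi-compact open set is a finite union of basic ones, and each basic preimage is the trace
of a quasi-compact open set on the closed subspace `supp X`. -/
lemma isSpectralMap_of_isTopologicalBasis {X : K} {Y : Type*} [TopologicalSpace Y]
    (ρ : supp X → Y) {ι : Type*} {b : ι → Set Y}
    (hb : TopologicalSpace.IsTopologicalBasis (Set.range b)) (c : ι → K)
    (h : ∀ i P, ρ P ∈ b i ↔ P.1.carrier (c i)) : IsSpectralMap ρ := by
  have hpre (i : ι) : ρ ⁻¹' b i = Subtype.val ⁻¹' (supp (c i))ᶜ := by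
    ext P
    exact (h i P).trans not_not.symm
  refine ⟨⟨?_⟩, ?_⟩
  · refine (hb.continuous_iff.2 ?_).isOpen_preimage
    rintro _ ⟨i, rfl⟩
    rw [hpre]
    exact (isClosed_supp (c i)).isOpen_compl.preimage continuous_subtype_val
  · intro s ho hc
    obtain ⟨t, ht, rfl⟩ := eq_finite_iUnion_of_isTopologicalBasis_of_isCompact_open b hb s hc ho
    rw [Set.preimage_iUnion₂]
    refine ht.isCompact_biUnion fun i _ => ?_
    rw [hpre]
    exact (isClosed_supp X).isClosedEmbedding_subtypeVal.isCompact_preimage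
      (isCompact_compl_supp (c i))

end Spectrum

/-! ### Whiskering identities. -/

section Whisker

lemma gradedMul_whiskerRight {K : Type u} [Category.{v} K] [HasShift K ℤ] [MonoidalCategory K]
    {X : K} {i j : ℤ} (f : X⟦i⟧ ⟶ X) (g : X⟦j⟧ ⟶ X) (d : K) :
    gradedMul f g ▷ d = (shiftFunctorAdd' K j i (i + j) (add_comm j i)).hom.app X ▷ d ≫
      g⟦i⟧' ▷ d ≫ f ▷ d := by
  simp [gradedMul]


variable {K : Type u} [Category.{v} K] [Preadditive K] [MonoidalCategory K] [MonoidalPreadditive K]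

lemma whiskerLeft_units_smul (a : K) {b c : K} (n : ℤˣ) (f : b ⟶ c) : a ◁ (n • f) = n • a ◁ f :=
  (tensorLeft a).map_units_smul n f

lemma whiskerRight_tensor_eq_zero_of_left {a b d : K} {f : a ⟶ b} (h : f ▷ d = 0) (e : K) :
    f ▷ (d ⊗ e) = 0 := by
  simp [whiskerRight_tensor, h]

lemma whiskerRight_tensor_eq_zero_of_right [SymmetricCategory K] {a b e : K} {f : a ⟶ b}
    (h : f ▷ e = 0) (d : K) :
    f ▷ (d ⊗ e) = 0 := by
  rw [← cancel_epi (a ◁ (β_ e d).hom), whisker_exchange,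
    whiskerRight_tensor_eq_zero_of_left h, zero_comp, comp_zero]

end Whisker

/-! ### Suspension against tensor product, with signs. -/

section ShiftTensor

variable {K : Type u} [Category.{v} K] [Preadditive K] [HasShift K ℤ]
  [∀ n : ℤ, (shiftFunctor K n).Additive] [MonoidalCategory K] [(curriedTensor K).CommShift₂Int]

lemma shiftTensorIso_naturality_left (n : ℤ) {a a' : K} (f : a ⟶ a') (b : K) :
    f⟦n⟧' ▷ b ≫ (shiftTensorIso n a' b).hom = (shiftTensorIso n a b).hom ≫ (f ▷ b)⟦n⟧' :=
  ((curriedTensor K).flip.obj b).commShiftIso_hom_naturality f n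

lemma tensorShiftIso_naturality_right (n : ℤ) (a : K) {b b' : K} (f : b ⟶ b') :
    a ◁ f⟦n⟧' ≫ (tensorShiftIso n a b').hom = (tensorShiftIso n a b).hom ≫ (a ◁ f)⟦n⟧' :=
  ((curriedTensor K).obj a).commShiftIso_hom_naturality f n

lemma shiftTensorIso_naturality_right (n : ℤ) (a : K) {b b' : K} (f : b ⟶ b') :
    a⟦n⟧ ◁ f ≫ (shiftTensorIso n a b').hom = (shiftTensorIso n a b).hom ≫ (a ◁ f)⟦n⟧' :=
  (NatTrans.shift_app_comm ((curriedTensor K).flip.map f) n a).symm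

lemma tensorShiftIso_naturality_left (n : ℤ) {a a' : K} (f : a ⟶ a') (b : K) :
    f ▷ b⟦n⟧ ≫ (tensorShiftIso n a' b).hom = (tensorShiftIso n a b).hom ≫ (f ▷ b)⟦n⟧' :=
  (NatTrans.shift_app_comm ((curriedTensor K).map f) n b).symm

/-- The sign axiom on `Σᵐ a ⊗ Σⁿ b` enters the proof only here. -/
lemma tensorShiftIso_comp_shiftTensorIso (m n : ℤ) (a b : K) :
    (tensorShiftIso n (a⟦m⟧) b).hom ≫ ((shiftTensorIso m a b).hom)⟦n⟧' =
      (m * n).negOnePow • ((shiftTensorIso m a (b⟦n⟧)).hom ≫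
        ((tensorShiftIso n a b).hom)⟦m⟧' ≫ (shiftComm (a ⊗ b) m n).inv) := by
  have h := Functor.CommShift₂.comm (curriedTensor K) .int a b m n
  simp only [CommShift₂Setup.int_ε, CatCenter.app_neg_one_zpow] at h
  refine h.trans ?_
  simp [shiftTensorIso, tensorShiftIso]

lemma whiskerLeft_shiftComm (m n : ℤ) (a b : K) :
    a ◁ (shiftComm b m n).hom = (tensorShiftIso n a (b⟦m⟧)).hom ≫
      ((tensorShiftIso m a b).hom)⟦n⟧' ≫ (shiftComm (a ⊗ b) m n).hom ≫
      ((tensorShiftIso n a b).inv)⟦m⟧' ≫ (tensorShiftIso m a (b⟦n⟧)).inv :=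
  ((curriedTensor K).obj a).map_shiftFunctorComm_hom_app b m n

/-- If `f` on the first factor can be traded for `g` on `Y`, it can be traded for `±Σⁿ g` on `Σⁿ Y`.
Allowing `Y` to differ from `X` lets the lemma be iterated. -/
lemma whiskerRight_shift (n : ℤ) {i : ℤ} {X Y : K} {f : X⟦i⟧ ⟶ X} {g : Y⟦i⟧ ⟶ Y}
    (h : f ▷ Y = (shiftTensorIso i X Y).hom ≫ (tensorShiftIso i X Y).inv ≫ X ◁ g) :
    f ▷ Y⟦n⟧ = (i * n).negOnePow • ((shiftTensorIso i X (Y⟦n⟧)).hom ≫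
      (tensorShiftIso i X (Y⟦n⟧)).inv ≫ X ◁ ((shiftComm Y n i).hom ≫ g⟦n⟧')) := by
  have hc : (shiftComm (X ⊗ Y) i n).inv = (shiftComm (X ⊗ Y) n i).hom := by
    rw [← shiftComm_symm (X ⊗ Y) n i, Iso.symm_inv]
  rw [← cancel_mono (tensorShiftIso n X Y).hom, tensorShiftIso_naturality_left, h,
    Functor.map_comp, ← Category.assoc, tensorShiftIso_comp_shiftTensorIso, hc]
  simp only [Linear.units_smul_comp, Category.assoc, whiskerLeft_comp, whiskerLeft_shiftComm,
    Functor.map_comp, tensorShiftIso_naturality_right, Iso.inv_hom_id_assoc]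

lemma IsGradedBalanced.whiskerRight_eq {X : K} {i : ℤ} {f : X⟦i⟧ ⟶ X} (hf : IsGradedBalanced f) :
    f ▷ X = (shiftTensorIso i X X).hom ≫ (tensorShiftIso i X X).inv ≫ X ◁ f := by
  have h : (shiftTensorIso i X X).inv ≫ f ▷ X = (tensorShiftIso i X X).inv ≫ X ◁ f := hf
  rw [← h, Iso.hom_inv_id_assoc]

lemma shift_whiskerRight_eq_zero (n : ℤ) {a b d : K} {f : a ⟶ b} (h : f ▷ d = 0) :
    f⟦n⟧' ▷ d = 0 := by
  rw [← cancel_mono (shiftTensorIso n b d).hom, shiftTensorIso_naturality_left, h,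
    Functor.map_zero, comp_zero, zero_comp]

lemma shift_whiskerRight_comp_whiskerLeft_eq_zero (n : ℤ) {a b c d : K} {f : a ⟶ b} {v : c ⟶ d}
    (h : f ▷ c ≫ b ◁ v = 0) : f⟦n⟧' ▷ c ≫ b⟦n⟧ ◁ v = 0 := by
  rw [← cancel_mono (shiftTensorIso n b d).hom, Category.assoc, shiftTensorIso_naturality_right,
    reassoc_of% @shiftTensorIso_naturality_left, ← Functor.map_comp, h, Functor.map_zero, comp_zero,
    zero_comp]

end ShiftTensor

/-! ### Cones and isomorphisms modulo a prime. -/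

section Cone

variable {K : Type u} [Category.{v} K] [Preadditive K] [HasZeroObject K] [HasShift K ℤ]
  [∀ n : ℤ, (shiftFunctor K n).Additive] [Pretriangulated K]

lemma exists_distinguished_cone {a b : K} (f : a ⟶ b) :
    ∃ (u : b ⟶ cone f) (v : cone f ⟶ a⟦(1 : ℤ)⟧), Triangle.mk f u v ∈ distTriang K :=
  (distinguished_cocone_triangle f).choose_spec

lemma carrier_cone_iff (P : ObjectProperty K) [P.IsClosedUnderIsomorphisms] {a b : K}
    (f : a ⟶ b) : P (cone f) ↔ P.trW f := by
  obtain ⟨u, v, h⟩ := exists_distinguished_cone f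
  exact (P.trW_iff_of_distinguished _ h).symm

/-- The target of a zero map is a retract of its cone. -/
lemma prop_tgt_of_trW_zero (P : ObjectProperty K) [P.IsTriangulated] [P.IsStableUnderRetracts]
    {a b : K} (h : P.trW (0 : a ⟶ b)) : P b := by
  obtain ⟨Z, u, v, hT, hZ⟩ := h
  obtain ⟨r, hr⟩ := Triangle.yoneda_exact₂ _ hT (𝟙 b) zero_comp
  exact P.prop_of_retract ⟨u, r, hr.symm⟩ hZ

end Cone

/-! ### The square of a balanced graded map kills its cone. -/

section Tensor

variable {K : Type u} [Category.{v} K] [Preadditive K] [HasZeroObject K] [HasShift K ℤ]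
  [∀ n : ℤ, (shiftFunctor K n).Additive] [Pretriangulated K] [IsTriangulated K]
  [MonoidalCategory K] [SymmetricCategory K] [MonoidalPreadditive K]
  [(curriedTensor K).CommShift₂Int] [TensorTriangulatedCategory K]

instance (a : K) : ((curriedTensor K).obj a).IsTriangulated :=
  TensorTriangulatedCategory.exact_left a

instance (b : K) : ((curriedTensor K).flip.obj b).IsTriangulated :=
  TensorTriangulatedCategory.exact_right b

lemma trW_whiskerRight (P : Spc K) {a b : K} {f : a ⟶ b} (hf : P.carrier.trW f) (d : K) :
    P.carrier.trW (f ▷ d) := by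
  obtain ⟨Z, u, v, hT, hZ⟩ := hf
  exact ObjectProperty.trW.mk _
    (((curriedTensor K).flip.obj d).map_distinguished _ hT) (P.tensor_right d hZ)

/-- If `f ▷ d` vanishes, then a prime containing the cone of `f : a ⟶ b` contains `b` or `d`. -/
lemma carrier_or_of_whiskerRight_eq_zero (P : Spc K) {a b d : K} {f : a ⟶ b}
    (hf : P.carrier.trW f) (h : f ▷ d = 0) : P.carrier b ∨ P.carrier d :=
  P.mem_or_mem (prop_tgt_of_trW_zero P.carrier (h ▸ trW_whiskerRight P hf d))

/-- A balanced graded endomorphism acts on its cone with square zero. -/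
lemma IsGradedBalanced.gradedMul_self_whiskerRight_cone {X : K} {i : ℤ} {f : X⟦i⟧ ⟶ X}
    (hf : IsGradedBalanced f) : gradedMul f f ▷ cone f = 0 := by
  obtain ⟨u, v, hT⟩ := exists_distinguished_cone f
  have hfu : f ≫ u = 0 := comp_distTriang_mor_zero₁₂ _ hT
  have hvf : v ≫ f⟦(1 : ℤ)⟧' = 0 := comp_distTriang_mor_zero₃₁ _ hT
  have hu : X⟦i⟧ ◁ u ≫ f ▷ cone f = 0 := by
    rw [whisker_exchange, hf.whiskerRight_eq, Category.assoc, Category.assoc,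
      ← whiskerLeft_comp, hfu, MonoidalPreadditive.whiskerLeft_zero, comp_zero, comp_zero]
  have hv : f ▷ cone f ≫ X ◁ v = 0 := by
    have hc (Y : K) : (shiftComm Y i i).hom = 𝟙 _ := by simp [shiftComm, shiftFunctorComm_eq_refl]
    -- The target of `v` is `Σ Σⁱ X`, so balancedness is transported first to `Σⁱ X`, then to its
    -- suspension. The signs are units and do not affect vanishing.
    have h₁ : f ▷ X⟦i⟧ = (shiftTensorIso i X (X⟦i⟧)).hom ≫ (tensorShiftIso i X (X⟦i⟧)).inv ≫
        X ◁ ((i * i).negOnePow • f⟦i⟧') := by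
      rw [whiskerRight_shift i hf.whiskerRight_eq, hc, Category.id_comp,
        whiskerLeft_units_smul, Linear.comp_units_smul, Linear.comp_units_smul]
    have h₂ : v⟦i⟧' ≫ (shiftComm (X⟦i⟧) 1 i).hom ≫ ((i * i).negOnePow • f⟦i⟧')⟦(1 : ℤ)⟧' = 0 := by
      rw [Functor.map_units_smul, Linear.comp_units_smul, shiftComm_hom_comp, Linear.comp_units_smul,
        ← Functor.map_comp_assoc, hvf, Functor.map_zero, zero_comp, smul_zero]
    rw [← whisker_exchange, whiskerRight_shift 1 h₁, Linear.comp_units_smul,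
      reassoc_of% @shiftTensorIso_naturality_right]
    have h₃ : (X ◁ v)⟦i⟧' ≫ (tensorShiftIso i X (X⟦i⟧⟦(1 : ℤ)⟧)).inv =
        (tensorShiftIso i X (cone f)).inv ≫ X ◁ v⟦i⟧' := by
      rw [Iso.eq_inv_comp, ← reassoc_of% @tensorShiftIso_naturality_right, Iso.hom_inv_id,
        Category.comp_id]
    rw [reassoc_of% h₃, ← whiskerLeft_comp, h₂, MonoidalPreadditive.whiskerLeft_zero, comp_zero,
      comp_zero, smul_zero]
  -- By `hu`, exactness of `Σⁱ X ⊗ -` factors `f ▷ cone f` through `X⟦i⟧ ◁ v`, which the shift of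
  -- `hv` kills.
  obtain ⟨w, hw⟩ := Triangle.yoneda_exact₃ _
    (((curriedTensor K).obj (X⟦i⟧)).map_distinguished _ hT) (f ▷ cone f) hu
  have hw' : f ▷ cone f = X⟦i⟧ ◁ v ≫ ((tensorShiftIso 1 (X⟦i⟧) (X⟦i⟧)).hom ≫ w) :=
    hw.trans (Category.assoc _ _ _)
  rw [gradedMul_whiskerRight]
  rw [hw']
  rw [← Category.assoc (f⟦i⟧' ▷ cone f), shift_whiskerRight_comp_whiskerLeft_eq_zero i hv,
    zero_comp, comp_zero]

end Tensor

/-! ### The ungraded comparison map. -/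

section BalancedHom

variable {K : Type u} [Category.{v} K] [Preadditive K] [MonoidalCategory K] [MonoidalPreadditive K]
  {A : Type w} [CommRing A] {X : K} (α : A →+* balancedEnd X)

/-- The morphism underlying the balanced endomorphism `α a`. -/
def balancedHom (a : A) : X ⟶ X := (α a).1

lemma balancedHom_add (a b : A) : balancedHom α (a + b) = balancedHom α a + balancedHom α b :=
  congrArg Subtype.val (map_add α a b)

lemma balancedHom_zero : balancedHom α 0 = 0 := congrArg Subtype.val (map_zero α)

lemma balancedHom_one : balancedHom α 1 = 𝟙 X := congrArg Subtype.val (map_one α)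

lemma balancedHom_mul (a b : A) : balancedHom α (a * b) = balancedHom α b ≫ balancedHom α a :=
  congrArg Subtype.val (map_mul α a b)

end BalancedHom

section Ungraded

variable {K : Type u} [Category.{v} K] [Preadditive K] [HasZeroObject K] [HasShift K ℤ]
  [∀ n : ℤ, (shiftFunctor K n).Additive] [Pretriangulated K] [IsTriangulated K]
  [MonoidalCategory K] [SymmetricCategory K] [MonoidalPreadditive K]
  [(curriedTensor K).CommShift₂Int] [TensorTriangulatedCategory K]

/-- A balanced endomorphism acts on its cone with square zero. -/
lemma comp_self_whiskerRight_cone {X : K} {f : X ⟶ X} (hf : f ▷ X = X ◁ f) :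
    (f ≫ f) ▷ cone f = 0 := by
  obtain ⟨u, v, hT⟩ := exists_distinguished_cone f
  have hfu : f ≫ u = 0 := comp_distTriang_mor_zero₁₂ _ hT
  have hvf : v ≫ f⟦(1 : ℤ)⟧' = 0 := comp_distTriang_mor_zero₃₁ _ hT
  have hu : X ◁ u ≫ f ▷ cone f = 0 := by
    rw [whisker_exchange, hf, ← whiskerLeft_comp, hfu, MonoidalPreadditive.whiskerLeft_zero]
  have hv : f ▷ cone f ≫ X ◁ v = 0 := by
    have h : f ▷ X⟦(1 : ℤ)⟧ = X ◁ f⟦(1 : ℤ)⟧' := by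
      rw [← cancel_mono (tensorShiftIso 1 X X).hom, tensorShiftIso_naturality_left,
        tensorShiftIso_naturality_right, hf]
    rw [← whisker_exchange, h, ← whiskerLeft_comp, hvf, MonoidalPreadditive.whiskerLeft_zero]
  obtain ⟨w, hw⟩ := Triangle.yoneda_exact₃ _
    (((curriedTensor K).obj X).map_distinguished _ hT) (f ▷ cone f) hu
  have hw' : f ▷ cone f = X ◁ v ≫ ((tensorShiftIso 1 X X).hom ≫ w) :=
    hw.trans (Category.assoc _ _ _)
  rw [comp_whiskerRight]
  exact (f ▷ cone f ≫= hw').trans (by rw [← Category.assoc, hv, zero_comp])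

variable {A : Type w} [CommRing A] {X : K} (α : A →+* balancedEnd X)

/-- The ideal of elements acting as zero on `X ⊗ d`. -/
def annihilator (d : K) : Ideal A where
  carrier := {a | balancedHom α a ▷ d = 0}
  zero_mem' := by
    simp only [Set.mem_ofPred_eq, balancedHom_zero, MonoidalPreadditive.zero_whiskerRight]
  add_mem' {a b} ha hb := by
    simp only [Set.mem_ofPred_eq] at ha hb ⊢
    rw [balancedHom_add, MonoidalPreadditive.add_whiskerRight, ha, hb, add_zero]
  smul_mem' a b hb := by
    simp only [Set.mem_ofPred_eq, smul_eq_mul] at hb ⊢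
    rw [balancedHom_mul, comp_whiskerRight, hb, zero_comp]

/-- The elements which become invertible modulo the prime `P`. -/
def invertibleModulo (P : Spc K) : Submonoid A where
  carrier := {a | P.carrier.trW (balancedHom α a)}
  one_mem' := by
    simp only [Set.mem_ofPred_eq, balancedHom_one]
    exact P.carrier.trW.id_mem X
  mul_mem' {a b} ha hb := by
    simp only [Set.mem_ofPred_eq, balancedHom_mul] at ha hb ⊢
    exact P.carrier.trW.comp_mem _ _ hb ha

lemma mul_self_mem_annihilator_cone (a : A) : a * a ∈ annihilator α (cone (balancedHom α a)) := by
  change balancedHom α (a * a) ▷ _ = 0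
  rw [balancedHom_mul]
  exact comp_self_whiskerRight_cone (α a).2

lemma carrier_of_mem_annihilator {P : Spc K} (hX : ¬ P.carrier X) {a : A} {d : K}
    (h : a ∈ invertibleModulo α P) (hd : a ∈ annihilator α d) : P.carrier d :=
  (carrier_or_of_whiskerRight_eq_zero P h hd).resolve_left hX

lemma mem_invertibleModulo_iff (P : Spc K) (a : A) :
    a ∈ invertibleModulo α P ↔ P.carrier (cone (balancedHom α a)) :=
  (carrier_cone_iff P.carrier _).symm

/-- The comparison map `supp X → Spec A`. -/
def comparison (P : supp X) : PrimeSpectrum A where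
  asIdeal :=
    { carrier := {a | a ∉ invertibleModulo α P.1}
      zero_mem' := fun h => P.1.not_carrier_unit
        (carrier_of_mem_annihilator α P.2 h (annihilator α (𝟙_ K)).zero_mem)
      add_mem' := fun {a b} ha hb h => by
        have hd : (a + b) ^ 3 ∈
            annihilator α (cone (balancedHom α a) ⊗ cone (balancedHom α b)) := by
          have h₁ : a * a ∈ annihilator α (cone (balancedHom α a) ⊗ cone (balancedHom α b)) :=
            whiskerRight_tensor_eq_zero_of_left (mul_self_mem_annihilator_cone α a) _
          have h₂ : b * b ∈ annihilator α (cone (balancedHom α a) ⊗ cone (balancedHom α b)) :=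
            whiskerRight_tensor_eq_zero_of_right (mul_self_mem_annihilator_cone α b) _
          -- Every cubic monomial in `a`, `b` contains `a²` or `b²`.
          rw [show (a + b) ^ 3 = (a + 3 * b) * (a * a) + (3 * a + b) * (b * b) by ring]
          exact Ideal.add_mem _ (Ideal.mul_mem_left _ _ h₁) (Ideal.mul_mem_left _ _ h₂)
        rcases P.1.mem_or_mem (carrier_of_mem_annihilator α P.2 (pow_mem h 3) hd) with h | h
        · exact ha ((mem_invertibleModulo_iff α P.1 a).2 h)
        · exact hb ((mem_invertibleModulo_iff α P.1 b).2 h)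
      smul_mem' := fun a b hb h => hb <| by
        rw [mem_invertibleModulo_iff]
        refine carrier_of_mem_annihilator α P.2 (pow_mem h 2) ?_
        rw [smul_eq_mul, mul_pow, sq b]
        exact Ideal.mul_mem_left _ _ (mul_self_mem_annihilator_cone α b) }
  isPrime :=
    { ne_top' := fun h => (Ideal.eq_top_iff_one _).1 h (one_mem (invertibleModulo α P.1))
      mem_or_mem' := fun {a b} h => by
        by_contra! hab
        exact h (mul_mem (not_not.1 hab.1) (not_not.1 hab.2)) }

lemma mem_comparison_iff (P : supp X) (a : A) :
    a ∈ (comparison α P).asIdeal ↔ ¬ P.1.carrier (cone (balancedHom α a)) :=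
  (mem_invertibleModulo_iff α P.1 a).not

lemma isSpectralMap_comparison : IsSpectralMap (comparison α) :=
  isSpectralMap_of_isTopologicalBasis _ PrimeSpectrum.isTopologicalBasis_basic_opens
    (fun a => cone (balancedHom α a)) fun a P => (mem_comparison_iff α P a).not.trans not_not

end Ungraded

/-! ### Basic open sets of the homogeneous spectrum. -/

section GradedRings

variable {A : Type w} [Ring A] {𝒜 : ℤ → AddSubgroup A} [GradedRing 𝒜]

lemma IsCommOrGradedComm.mul_eq_or (hA : IsCommOrGradedComm 𝒜) {i j : ℤ} {a b : A}
    (ha : a ∈ 𝒜 i) (hb : b ∈ 𝒜 j) : a * b = b * a ∨ a * b = -(b * a) := by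
  obtain h | h := hA
  · exact .inl (h a b)
  · rw [h i j a b ha hb]
    obtain h | h := Int.units_eq_one_or ((-1 : ℤˣ) ^ (i * j)) <;> simp [h]

lemma isTopologicalBasis_spech (hA : IsCommOrGradedComm 𝒜) :
    TopologicalSpace.IsTopologicalBasis
      (Set.range fun a : {a : A // SetLike.IsHomogeneousElem 𝒜 a} =>
        {p : Spech 𝒜 | a.1 ∉ p.asIdeal.toIdeal}) := by
  refine TopologicalSpace.isTopologicalBasis_of_subbasis_of_finiteInter ?_ ⟨?_, ?_⟩
  · refine congrArg TopologicalSpace.generateFrom (Set.ext fun U => ?_)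
    exact ⟨fun ⟨a, ha, h⟩ => ⟨⟨a, ha⟩, h.symm⟩, fun ⟨a, h⟩ => ⟨a.1, a.2, h.symm⟩⟩
  · refine ⟨⟨1, 0, SetLike.GradedOne.one_mem⟩, Set.eq_univ_of_forall fun p h => ?_⟩
    exact p.ne_top ((Ideal.eq_top_iff_one _).2 h)
  · rintro _ ⟨⟨a, i, ha⟩, rfl⟩ _ ⟨⟨b, j, hb⟩, rfl⟩
    refine ⟨⟨a * b, i + j, SetLike.GradedMul.mul_mem ha hb⟩, Set.ext fun p => ?_⟩
    refine Iff.trans (not_congr ⟨p.mem_or_mem ⟨i, ha⟩ ⟨j, hb⟩, ?_⟩) not_or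
    intro h
    -- Ideals are left ideals, so when `a ∈ p` the factors are exchanged up to sign.
    change a * b ∈ p.asIdeal.toIdeal
    rcases h with h | h
    · obtain h' | h' := hA.mul_eq_or ha hb
      · rw [h']
        exact Ideal.mul_mem_left _ _ h
      · rw [h']
        exact neg_mem (Ideal.mul_mem_left _ _ h)
    · exact Ideal.mul_mem_left _ _ h

end GradedRings

/-! ### The graded comparison map. -/

section GradedComparison

variable {K : Type u} [Category.{v} K] [Preadditive K] [HasZeroObject K] [HasShift K ℤ]
  [∀ n : ℤ, (shiftFunctor K n).Additive] [Pretriangulated K] [IsTriangulated K]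
  [MonoidalCategory K] [SymmetricCategory K] [MonoidalPreadditive K]
  [(curriedTensor K).CommShift₂Int] [TensorTriangulatedCategory K]
  {A : Type w} [Ring A] {𝒜 : ℤ → AddSubgroup A} [GradedRing 𝒜] {X : K}
  (α : GradedHomToBalanced 𝒜 X)

namespace GradedHomToBalanced

/-- The elements of degree `i` acting as zero on `X ⊗ d`. -/
def annihilator (d : K) (i : ℤ) : AddSubgroup A where
  carrier := {a | ∃ h : a ∈ 𝒜 i, α.toFun i ⟨a, h⟩ ▷ d = 0}
  zero_mem' := ⟨zero_mem _, by
    rw [show (⟨0, zero_mem _⟩ : 𝒜 i) = 0 from rfl, map_zero,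
      MonoidalPreadditive.zero_whiskerRight]⟩
  add_mem' := by
    rintro a b ⟨ha, ha'⟩ ⟨hb, hb'⟩
    refine ⟨add_mem ha hb, ?_⟩
    rw [show (⟨a + b, add_mem ha hb⟩ : 𝒜 i) = ⟨a, ha⟩ + ⟨b, hb⟩ from rfl, map_add,
      MonoidalPreadditive.add_whiskerRight, ha', hb', add_zero]
  neg_mem' := by
    rintro a ⟨ha, ha'⟩
    refine ⟨neg_mem ha, ?_⟩
    rw [show (⟨-a, neg_mem ha⟩ : 𝒜 i) = -⟨a, ha⟩ from rfl, map_neg]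
    exact ((tensorRight d).map_neg).trans (neg_eq_zero.2 ha')

lemma mul_mem_annihilator_of_left {d : K} {i j : ℤ} {a b : A} (ha : a ∈ α.annihilator d i)
    (hb : b ∈ 𝒜 j) : a * b ∈ α.annihilator d (i + j) := by
  obtain ⟨ha, ha'⟩ := ha
  refine ⟨SetLike.GradedMul.mul_mem ha hb, ?_⟩
  rw [α.map_mul i j ⟨a, ha⟩ ⟨b, hb⟩, gradedMul_whiskerRight, ha', comp_zero, comp_zero]

lemma mul_mem_annihilator_of_right {d : K} {i j : ℤ} {a b : A} (ha : a ∈ 𝒜 i)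
    (hb : b ∈ α.annihilator d j) : a * b ∈ α.annihilator d (i + j) := by
  obtain ⟨hb, hb'⟩ := hb
  refine ⟨SetLike.GradedMul.mul_mem ha hb, ?_⟩
  rw [α.map_mul i j ⟨a, ha⟩ ⟨b, hb⟩, gradedMul_whiskerRight, shift_whiskerRight_eq_zero i hb',
    zero_comp, comp_zero]

lemma mul_self_mem_annihilator_cone {i : ℤ} (a : 𝒜 i) :
    (a * a : A) ∈ α.annihilator (cone (α.toFun i a)) (i + i) := by
  refine ⟨SetLike.GradedMul.mul_mem a.2 a.2, ?_⟩
  rw [α.map_mul]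
  exact (α.balanced i a).gradedMul_self_whiskerRight_cone

lemma annihilator_le_tensor_left (d e : K) (i : ℤ) :
    α.annihilator d i ≤ α.annihilator (d ⊗ e) i :=
  fun _ ⟨h, h'⟩ => ⟨h, whiskerRight_tensor_eq_zero_of_left h' e⟩

lemma annihilator_le_tensor_right (d e : K) (i : ℤ) :
    α.annihilator e i ≤ α.annihilator (d ⊗ e) i :=
  fun _ ⟨h, h'⟩ => ⟨h, whiskerRight_tensor_eq_zero_of_right h' d⟩

/-- The elements of degree `i` which become invertible modulo the prime `P`. -/
def invertibleModulo (P : Spc K) (i : ℤ) : Set A :=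
  {a | ∃ h : a ∈ 𝒜 i, P.carrier.trW (α.toFun i ⟨a, h⟩)}

lemma mem_invertibleModulo_iff (P : Spc K) {i : ℤ} (a : 𝒜 i) :
    (a : A) ∈ α.invertibleModulo P i ↔ P.carrier (cone (α.toFun i a)) := by
  rw [carrier_cone_iff P.carrier]
  exact ⟨fun h => h.2, fun h => ⟨a.2, h⟩⟩

lemma one_mem_invertibleModulo (P : Spc K) : (1 : A) ∈ α.invertibleModulo P 0 := by
  refine ⟨SetLike.GradedOne.one_mem, ?_⟩
  rw [α.map_one]
  exact P.carrier.trW_of_isIso ((shiftFunctorZero K ℤ).hom.app X)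

lemma mul_mem_invertibleModulo {P : Spc K} {i j : ℤ} {a b : A} (ha : a ∈ α.invertibleModulo P i)
    (hb : b ∈ α.invertibleModulo P j) : a * b ∈ α.invertibleModulo P (i + j) := by
  obtain ⟨ha, ha'⟩ := ha
  obtain ⟨hb, hb'⟩ := hb
  refine ⟨SetLike.GradedMul.mul_mem ha hb, ?_⟩
  rw [α.map_mul i j ⟨a, ha⟩ ⟨b, hb⟩]
  exact P.carrier.trW.comp_mem _ _
    (P.carrier.trW_of_isIso ((shiftFunctorAdd' K j i (i + j) (add_comm j i)).hom.app X))
    (P.carrier.trW.comp_mem _ _ (hb'.shift i) ha')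

lemma carrier_of_mem_annihilator {P : Spc K} (hX : ¬ P.carrier X) {i : ℤ} {a : A} {d : K}
    (h : a ∈ α.invertibleModulo P i) (hd : a ∈ α.annihilator d i) : P.carrier d :=
  (carrier_or_of_whiskerRight_eq_zero P h.2 hd.2).resolve_left hX

lemma zero_notMem_invertibleModulo {P : Spc K} (hX : ¬ P.carrier X) (i : ℤ) :
    (0 : A) ∉ α.invertibleModulo P i := fun h =>
  P.not_carrier_unit (α.carrier_of_mem_annihilator hX h (zero_mem _))

lemma add_notMem_invertibleModulo (hA : IsCommOrGradedComm 𝒜) {P : Spc K} (hX : ¬ P.carrier X)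
    {i : ℤ} {a b : 𝒜 i} (ha : (a : A) ∉ α.invertibleModulo P i)
    (hb : (b : A) ∉ α.invertibleModulo P i) : (a + b : A) ∉ α.invertibleModulo P i := by
  intro h
  rw [mem_invertibleModulo_iff] at ha hb
  suffices P.carrier (cone (α.toFun i a) ⊗ cone (α.toFun i b)) from
    (P.mem_or_mem this).elim ha hb
  have h₁ := α.annihilator_le_tensor_left _ (cone (α.toFun i b)) _
    (α.mul_self_mem_annihilator_cone a)
  have h₂ := α.annihilator_le_tensor_right (cone (α.toFun i a)) _ _
    (α.mul_self_mem_annihilator_cone b)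
  obtain hab | hab := hA.mul_eq_or a.2 b.2
  · refine α.carrier_of_mem_annihilator hX
      (α.mul_mem_invertibleModulo (α.mul_mem_invertibleModulo h h) h) ?_
    have e : ((a + b) * (a + b) * (a + b) : A) =
        a * a * (a + (b + b + b)) + b * b * (b + (a + a + a)) := by
      have h₃ : (a * b * a : A) = a * a * b := by rw [mul_assoc, ← hab, mul_assoc]
      have h₄ : (a * b * b : A) = b * b * a := by rw [hab, mul_assoc, hab, mul_assoc]
      simp only [add_mul, mul_add, ← hab, h₃, h₄]
      abel
    rw [e]
    refine add_mem (α.mul_mem_annihilator_of_left h₁ ?_) (α.mul_mem_annihilator_of_left h₂ ?_)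
    · exact add_mem a.2 (add_mem (add_mem b.2 b.2) b.2)
    · exact add_mem b.2 (add_mem (add_mem a.2 a.2) a.2)
  -- In the anticommuting case the cross terms cancel, so the square suffices in place of the cube.
  · refine α.carrier_of_mem_annihilator hX (α.mul_mem_invertibleModulo h h) ?_
    have e : ((a + b) * (a + b) : A) = a * a + b * b := by
      rw [mul_add, add_mul, add_mul, hab]
      abel
    rw [e]
    exact add_mem h₁ h₂

lemma mul_notMem_invertibleModulo (hA : IsCommOrGradedComm 𝒜) {P : Spc K} (hX : ¬ P.carrier X)
    {i j : ℤ} {a : A} (ha : a ∈ 𝒜 i) {b : 𝒜 j} (hb : (b : A) ∉ α.invertibleModulo P j) :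
    a * b ∉ α.invertibleModulo P (i + j) := by
  intro h
  rw [mem_invertibleModulo_iff] at hb
  refine hb (α.carrier_of_mem_annihilator hX (α.mul_mem_invertibleModulo h h) ?_)
  have hm := α.mul_mem_annihilator_of_right (SetLike.GradedMul.mul_mem ha ha)
    (α.mul_self_mem_annihilator_cone b)
  rw [add_add_add_comm i i j j] at hm
  obtain hab | hab := hA.mul_eq_or ha b.2
  · rwa [show a * b * (a * b) = a * a * (b * b : A) by
      rw [mul_assoc, ← mul_assoc (b : A), ← hab]; simp only [mul_assoc]]
  · rw [show a * b * (a * b) = -(a * a * (b * b : A)) by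
      rw [mul_assoc, ← mul_assoc (b : A), eq_neg_of_add_eq_zero_right (add_eq_zero_iff_eq_neg.2 hab)]
      simp only [mul_assoc, neg_mul, mul_neg]]
    exact neg_mem hm

/-- The elements all of whose homogeneous components are not invertible modulo `P`. -/
def nonInvertibleIdeal (hA : IsCommOrGradedComm 𝒜) (P : supp X) : Ideal A where
  carrier := {x | ∀ i, (DirectSum.decompose 𝒜 x i : A) ∉ α.invertibleModulo P.1 i}
  zero_mem' i := by
    rw [DirectSum.decompose_zero]
    exact α.zero_notMem_invertibleModulo P.2 i
  add_mem' {x y} hx hy i := by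
    rw [DirectSum.decompose_add]
    exact α.add_notMem_invertibleModulo hA P.2 (hx i) (hy i)
  smul_mem' r x hx := by
    induction r using DirectSum.Decomposition.inductionOn 𝒜 with
    | zero =>
      intro i
      rw [zero_smul, DirectSum.decompose_zero]
      exact α.zero_notMem_invertibleModulo P.2 i
    | @homogeneous j r =>
      intro i
      -- The degree `i` component of `r x` is `r` times the degree `i - j` component of `x`.
      obtain ⟨k, rfl⟩ : ∃ k, i = j + k := ⟨i - j, by ring⟩
      rw [smul_eq_mul, DirectSum.coe_decompose_mul_add_of_left_mem 𝒜 r.2]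
      exact α.mul_notMem_invertibleModulo hA P.2 r.2 (hx k)
    | add r s hr hs =>
      intro i
      rw [add_smul, DirectSum.decompose_add]
      exact α.add_notMem_invertibleModulo hA P.2 (hr i) (hs i)

lemma mem_nonInvertibleIdeal_iff (hA : IsCommOrGradedComm 𝒜) (P : supp X) {i : ℤ} {a : A}
    (ha : a ∈ 𝒜 i) : a ∈ α.nonInvertibleIdeal hA P ↔ a ∉ α.invertibleModulo P.1 i := by
  refine ⟨fun h => ?_, fun h j => ?_⟩
  · have := h i
    rwa [DirectSum.decompose_of_mem_same 𝒜 ha] at this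
  · by_cases hij : i = j
    · subst hij
      rwa [DirectSum.decompose_of_mem_same 𝒜 ha]
    · rw [DirectSum.decompose_of_mem_ne 𝒜 ha hij]
      exact α.zero_notMem_invertibleModulo P.2 j

/-- The graded comparison map `supp X → Specʰ A`. -/
def comparison (hA : IsCommOrGradedComm 𝒜) (P : supp X) : Spech 𝒜 where
  asIdeal :=
    { α.nonInvertibleIdeal hA P with
      is_homogeneous' := fun i _ hx =>
        (α.mem_nonInvertibleIdeal_iff hA P (SetLike.coe_mem _)).2 (hx i) }
  ne_top h := (α.mem_nonInvertibleIdeal_iff hA P SetLike.GradedOne.one_mem).1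
    ((Ideal.eq_top_iff_one _).1 h) (α.one_mem_invertibleModulo P.1)
  mem_or_mem := by
    rintro a b ⟨i, ha⟩ ⟨j, hb⟩ h
    have h' := (α.mem_nonInvertibleIdeal_iff hA P (SetLike.GradedMul.mul_mem ha hb)).1 h
    by_contra! hab
    refine h' (α.mul_mem_invertibleModulo ?_ ?_)
    · exact not_not.1 ((α.mem_nonInvertibleIdeal_iff hA P ha).not.1 hab.1)
    · exact not_not.1 ((α.mem_nonInvertibleIdeal_iff hA P hb).not.1 hab.2)

lemma mem_comparison_iff (hA : IsCommOrGradedComm 𝒜) (P : supp X) {i : ℤ} (a : 𝒜 i) :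
    (a : A) ∈ (α.comparison hA P).asIdeal.toIdeal ↔ ¬ P.1.carrier (cone (α.toFun i a)) :=
  (α.mem_nonInvertibleIdeal_iff hA P a.2).trans (α.mem_invertibleModulo_iff P.1 a).not

lemma comparison_antitone (hA : IsCommOrGradedComm 𝒜) {P Q : supp X}
    (h : P.1.carrier ≤ Q.1.carrier) :
    (α.comparison hA Q).asIdeal.toIdeal ≤ (α.comparison hA P).asIdeal.toIdeal :=
  fun _ hx i hi => hx i ⟨hi.1, ObjectProperty.trW_monotone h _ hi.2⟩

lemma isSpectralMap_comparison (hA : IsCommOrGradedComm 𝒜) : IsSpectralMap (α.comparison hA) :=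
  isSpectralMap_of_isTopologicalBasis _ (isTopologicalBasis_spech hA)
    -- Zero has every degree, but any choice serves: `mem_comparison_iff` holds in each degree.
    (fun a => cone (α.toFun a.2.choose ⟨a.1, a.2.choose_spec⟩)) fun a P =>
      (α.mem_comparison_iff hA P ⟨a.1, a.2.choose_spec⟩).not.trans not_not

end GradedHomToBalanced

end GradedComparison

end TTGeometry

theorem mainTheorem3
    {K : Type u} [CategoryTheory.Category.{v} K] [CategoryTheory.Preadditive K]
    [CategoryTheory.Limits.HasZeroObject K] [CategoryTheory.HasShift K ℤ]
    [∀ n : ℤ, (CategoryTheory.shiftFunctor K n).Additive]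
    [CategoryTheory.Pretriangulated K] [CategoryTheory.IsTriangulated K]
    [CategoryTheory.MonoidalCategory K] [CategoryTheory.SymmetricCategory K]
    [CategoryTheory.MonoidalPreadditive K]
    [(CategoryTheory.MonoidalCategory.curriedTensor K).CommShift₂Int]
    [TTGeometry.TensorTriangulatedCategory K] (X : K) :
    (∀ (A : Type w) [CommRing A] (α : A →+* TTGeometry.balancedEnd X),
      ∃ ρ : TTGeometry.supp X → PrimeSpectrum A,
        (∀ (P : TTGeometry.supp X) (a : A),
          a ∈ (ρ P).asIdeal ↔ ¬ P.1.carrier (TTGeometry.cone (a := X) (b := X) (α a).1)) ∧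
        (∀ P Q : TTGeometry.supp X, P.1.carrier ≤ Q.1.carrier →
          (ρ Q).asIdeal ≤ (ρ P).asIdeal) ∧
        IsSpectralMap ρ) ∧
    (∀ (A : Type w) [Ring A] (𝒜 : ℤ → AddSubgroup A) [GradedRing 𝒜]
      (_ : TTGeometry.IsCommOrGradedComm 𝒜) (α : TTGeometry.GradedHomToBalanced 𝒜 X),
      ∃ ρ : TTGeometry.supp X → TTGeometry.Spech 𝒜,
        (∀ (P : TTGeometry.supp X) (i : ℤ) (a : 𝒜 i),
          (a : A) ∈ (ρ P).asIdeal.toIdeal ↔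
            ¬ P.1.carrier (TTGeometry.cone (α.toFun i a))) ∧
        (∀ P Q : TTGeometry.supp X, P.1.carrier ≤ Q.1.carrier →
          (ρ Q).asIdeal.toIdeal ≤ (ρ P).asIdeal.toIdeal) ∧
        IsSpectralMap ρ) := by
  refine ⟨fun A _ α => ⟨TTGeometry.comparison α, TTGeometry.mem_comparison_iff α,
    fun P Q h a ha => ?_, TTGeometry.isSpectralMap_comparison α⟩, fun A _ 𝒜 _ hA α =>
    ⟨α.comparison hA, fun P i a => α.mem_comparison_iff hA P a,
      fun P Q h => α.comparison_antitone hA h, α.isSpectralMap_comparison hA⟩⟩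
  rw [TTGeometry.mem_comparison_iff] at ha ⊢
  exact fun h' => ha (h _ h')
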